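/- **Setting.** Points lie in a (pseudo)metric space. For a finite weighted instance $W$ (a finite multiset of pairs: a point $y$ with a weight $w\in\mathbb N$) and a finite set $\mathcal U$ of points let $\mathrm{cost}(\mathcal U,W)=\sum_{(y,w)\in W} w\cdot \mathrm{dist}(y,\mathcal U)$, where $\mathrm{dist}(y,\emptyset)=\Delta$, and let $\mathrm{OPT}(W)$ be the minimum of $\mathrm{cost}(\mathcal U,W)$ over all sets $\mathcal U$ of at most $k$ points of $W$. Such a set $\mathcal U$ is an $\alpha$-approximate solution for $W$ if $\mathrm{cost}(\mathcal U,W)\le\alpha\,\mathrm{OPT}(W)$. An unweighted instance has all weights $1$; inserted points that coincide count as distinct points at distance $0$. **The Multi-Meyerson procedure.** Parameters: $k\ge 1$, $n$, $\Delta\ge 1$, an estimate $G$ and a number $q$ of copies. It reads the initial points $P'$, in any order, and then the points of a stream $\sigma'=\langle\sigma'_1,\dots,\sigma'_{t'}\rangle$, one at a time. Each copy $i\le q$ keeps a set $S^{(i)}$ of centers, initially empty. When $x$ is inserted, each copy independently adds $x$ to $S^{(i)}$ with probability $\min\{1,\ \mathrm{dist}(x,S^{(i)})\cdot k(\log_2\Delta+1)/G\}$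 (here $\mathrm{dist}(x,\emptyset)=\infty$, and $a/0=\infty$ for $a>0$, $0/0=0$). If some copy $i$ added $x$ and now $|S^{(i)}|\le 292\,k(\log_2\Delta+1)$, then $x$ is output with weight $1$, and $w(x):=1$. Otherwise $w(y)$ is increased by one for the point $y$ closest to $x$ among all points output before (the earliest one in case of ties), and if the new $w(y)$ is a power of two, then $y$ is output again with weight $w(y)$. The weighted points output while $P'$ is read form $P$; those output afterwards form, in order, the stream $\sigma$. Thus $\sigma$ is built on the fly. **Theorem (Multi-Meyerson procedure).** There are universal constants $c,C,A>0$ and $a\in\mathbb N$ such that the following holds. Let $k\ge1$, $\Delta\ge1$, let $P'$ be a finite family of initial points and $\sigma'=\langle\sigma'_1,\dots,\sigma'_{t'}\rangle$ a stream with $|P'|+t'\le n$ such that all non-zero distances between these points lie in $[1,\Delta]$ and $$\mathrm{OPT}(P'\cup\{\sigma'_1,\dots,\sigma'_{t'}\})\le 18\,\mathrm{OPT}(P').$$ Let $\mathrm{OPT}(P')\le G\le 3\,\mathrm{OPT}(P')$. Run the Multi-Meyerson procedure with estimate $G$ and $q=\lceil c\log_2(n+\Delta)\rceil$ copies, and let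 $P$ and $\sigma$ be its output. Then: 1. The length of $\sigma$ is always at most $k\cdot A\,(\log_2(n+\Delta))^{a}$. 2. The weights in $P\cup\sigma$ are always positive integers, and their sum is at most $2n$. 3. With probability at least $1-\frac1{(n+\Delta)^{10}}$ the following holds for all $0\le j\le t'$ simultaneously: if $\langle\sigma_1,\dots,\sigma_i\rangle$ is the part of $\sigma$ output by the time of the $j$-th insertion of $\sigma'$, then for every $\alpha\ge0$ each $\alpha$-approximate solution $\mathcal U$ for the weighted instance $P\cup\{\sigma_1,\dots,\sigma_i\}$ is a $C(\alpha+1)$-approximate solution for $P'\cup\{\sigma'_1,\dots,\sigma'_j\}$. -/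

import Mathlib

open scoped ENNReal

noncomputable section

namespace MultiMeyerson

/-! ### The `k`-median problem

An instance is a finite list of weighted points; an unweighted instance has all weights one.
Repeated entries are distinct points (they contribute separately to the cost). -/

/-- `dist(x, U)`, the distance from `x` to the closest point of `U`, with `dist(x, ∅) = Δ`. -/
def distTo {X : Type*} [PseudoMetricSpace X] (Δ : ℝ) (x : X) (U : Finset X) : ℝ :=
  if h : U.Nonempty then U.inf' h (fun u => dist x u) else Δ

/-- `cost(U, W)`: the weighted sum of the distances of the points of `W` to `U`. -/
def cost {X : Type*} [PseudoMetricSpace X] (Δ : ℝ) (U : Finset X) (W : List (X × ℕ)) : ℝ :=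
  (W.map (fun p => (p.2 : ℝ) * distTo Δ p.1 U)).sum

/-- The points of `P`, each with weight one. -/
def unitWeights {X : Type*} (P : List X) : List (X × ℕ) :=
  P.map (fun x => (x, 1))

open Classical in
/-- The feasible sets of centers: at most `k` of the points of the instance. -/
def centerSets {X : Type*} (k : ℕ) (W : List (X × ℕ)) : Finset (Finset X) :=
  (W.map Prod.fst).toFinset.powerset.filter (fun U => U.card ≤ k)

theorem centerSets_nonempty {X : Type*} (k : ℕ) (W : List (X × ℕ)) :
    (centerSets k W).Nonempty :=
  ⟨∅, by simp [centerSets]⟩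

/-- `OPT(W)`: the minimum cost of a feasible set of centers. -/
def opt {X : Type*} [PseudoMetricSpace X] (k : ℕ) (Δ : ℝ) (W : List (X × ℕ)) : ℝ :=
  (centerSets k W).inf' (centerSets_nonempty k W) (fun U => cost Δ U W)

/-- `U` is a feasible set of centers of `W` whose cost is at most `α · OPT(W)`. -/
def IsApproxSolution {X : Type*} [PseudoMetricSpace X] (k : ℕ) (Δ α : ℝ)
    (U : Finset X) (W : List (X × ℕ)) : Prop :=
  U ∈ centerSets k W ∧ cost Δ U W ≤ α * opt k Δ W

/-! ### Meyerson's sketch -/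

/-- The probability `min {1, dist(x, S) · k (log₂ Δ + 1) / G}` of opening `x` when the open centers
are `S`. In `ℝ≥0∞` the infimum over the empty list is `∞`, `a / 0 = ∞` for `a ≠ 0`, and
`0 / 0 = 0`. -/
def openProb {X : Type*} [PseudoMetricSpace X] (k : ℕ) (Δ G : ℝ) (S : List X) (x : X) : ℝ≥0∞ :=
  min 1 ((⨅ y ∈ S, edist x y) * ENNReal.ofReal (k * (Real.logb 2 Δ + 1)) / ENNReal.ofReal G)

theorem openProb_le_one {X : Type*} [PseudoMetricSpace X] (k : ℕ) (Δ G : ℝ) (S : List X) (x : X) :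
    openProb k Δ G S x ≤ 1 :=
  min_le_left _ _

/-- Independent coins, the `i`-th of which shows `true` with probability `h i`. -/
def coinFlips {q : ℕ} (h : Fin q → ℝ≥0∞) (hh : ∀ i, h i ≤ 1) : PMF (Fin q → Bool) :=
  PMF.ofFintype (fun b => ∏ i, if b i then h i else 1 - h i) (by
    have key := Finset.prod_univ_sum (fun _ : Fin q => (Finset.univ : Finset Bool))
      (fun i c => if c = true then h i else 1 - h i)
    rw [Fintype.piFinset_univ] at key
    rw [← key]
    refine Finset.prod_eq_one fun i _ => ?_
    simp [add_tsub_cancel_of_le (hh i)])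

/-! ### The Multi-Meyerson procedure -/

/-- The state of the procedure with `q` parallel copies of Meyerson's sketch.
* `centers i`: the centers opened so far by the `i`-th copy;
* `sketch`: the points that were output so far, each listed once with its current
  dynamic weight `w`;
* `transcript`: one entry per insertion, the weighted point that was appended to the output stream
  because of that insertion, or `none`. -/
structure State (X : Type*) (q : ℕ) where
  centers : Fin q → List X
  sketch : List (X × ℕ)
  transcript : List (Option (X × ℕ))

/-- The state before the first insertion. -/
def State.init (X : Type*) (q : ℕ) : State X q where
  centers := fun _ => []
  sketch := []
  transcript := []

/-- The position in `L` of a point closest to `x` (the first one in case of ties). -/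
def nearest {X : Type*} [PseudoMetricSpace X] (x : X) (L : List (X × ℕ)) : Option (Fin L.length) :=
  (List.finRange L.length).argmin (fun r => dist x (L.get r).1)

open Classical in
/-- Processing the insertion of `x` when the copies `i` with `b i = true` open `x`. If one of these
copies now has at most `292 k (log₂ Δ + 1)` centers, then `x` is output with weight one. Otherwise
`x` is assigned to the closest point `y` that was output before, whose dynamic weight `w` increases
by one, and `y` is output again with weight `w` if the new `w` is a power of two. -/
def update {X : Type*} [PseudoMetricSpace X] {q : ℕ} (k : ℕ) (Δ : ℝ)
    (s : State X q) (x : X) (b : Fin q → Bool) : State X q :=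
  let centers' : Fin q → List X := fun i => if b i then x :: s.centers i else s.centers i
  if ∃ i, b i = true ∧ ((centers' i).length : ℝ) ≤ 292 * k * (Real.logb 2 Δ + 1) then
    { centers := centers'
      sketch := s.sketch ++ [(x, 1)]
      transcript := s.transcript ++ [some (x, 1)] }
  else
    match nearest x s.sketch with
    | none =>
      { centers := centers'
        sketch := s.sketch
        transcript := s.transcript ++ [none] }
    | some r =>
      let y : X := (s.sketch.get r).1
      let w : ℕ := (s.sketch.get r).2 + 1
      { centers := centers'
        sketch := s.sketch.set r (y, w)
        transcript := s.transcript ++ [if ∃ l : ℕ, w = 2 ^ l then some (y, w) else none] }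

/-- One step of the procedure: each copy decides independently whether to open `x`. -/
def step {X : Type*} [PseudoMetricSpace X] {q : ℕ} (k : ℕ) (Δ G : ℝ)
    (s : State X q) (x : X) : PMF (State X q) :=
  (coinFlips (fun i => openProb k Δ G (s.centers i) x)
    (fun i => openProb_le_one k Δ G (s.centers i) x)).map (update k Δ s x)

/-- The procedure reads the points of a stream one after the other. -/
def run {X : Type*} [PseudoMetricSpace X] {q : ℕ} (k : ℕ) (Δ G : ℝ) :
    State X q → List X → PMF (State X q)
  | s, [] => PMF.pure s
  | s, x :: xs => (step k Δ G s x).bind (fun s' => run k Δ G s' xs)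

/-- The law of the transcript of the procedure with `q` copies and estimate `G`, on the initial
points `P'` followed by the stream `σ'`. -/
def procedure {X : Type*} [PseudoMetricSpace X] (k q : ℕ) (Δ G : ℝ) (P' σ' : List X) :
    PMF (List (Option (X × ℕ))) :=
  (run k Δ G (State.init X q) (P' ++ σ')).map State.transcript

/-- The weighted initial solution: what was output during the first `p` insertions. -/
def initialPart {X : Type*} (p : ℕ) (τ : List (Option (X × ℕ))) : List (X × ℕ) :=
  (τ.take p).reduceOption

/-- The stream output during the `j` insertions that follow the first `p` ones. -/
def streamPart {X : Type*} (p j : ℕ) (τ : List (Option (X × ℕ))) : List (X × ℕ) :=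
  ((τ.drop p).take j).reduceOption

end MultiMeyerson

end

noncomputable section

namespace MultiMeyerson

variable {X : Type*} [PseudoMetricSpace X] {q : ℕ}

/-! ### Costs -/

/-! Two claims are deterministic. A sketch point of dynamic weight `w` has been output with exactly
the powers of two up to `w`. That makes `Nat.log 2 w + 1` outputs of total weight between `w` and `2
* w`. Each sketch point is paid for by a copy still within its budget, so the sketch has at most `q`
times the budget many points. `Consistent` records this for every outcome.

For the quality, write `K = k (log₂ Δ + 1)` and charge a copy `1` for each center it opens and
`dist(x, S) K / G` for each point `x` it leaves closed. While the charge of some copy is at most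
`292 K`, all centers of that copy lie in the sketch. Hence assigning `x` moves it by at most its
distance to those centers, and the total movement is at most `292 G` (`Tracks.update`). Movement and
rounding distort sums of nonnegative 1-Lipschitz functions only up to a constant factor and an
additive `O(G)`. For distances to center sets this transfers approximate solutions
(`Represents.isApproxSolution`).

A copy exceeds its charge budget with probability at most 1/2: group the points by optimal center
and dyadic distance (`exists_labels`), bound the expected charge by a potential, and apply Markov
(`failProb_le`). The coins of the copies are independent, so all copies fail with probability at
most `2⁻¹ ^ q` (`run_toOuterMeasure_le`). The charge only grows, so one good copy covers all
prefixes at once. -/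

theorem distTo_nonneg {Δ : ℝ} (hΔ : 0 ≤ Δ) (x : X) (U : Finset X) : 0 ≤ distTo Δ x U := by
  unfold distTo
  split_ifs with h
  · exact Finset.le_inf' h _ fun u _ => dist_nonneg
  · exact hΔ

theorem distTo_le_dist {Δ : ℝ} (x : X) {U : Finset X} {u : X} (hu : u ∈ U) :
    distTo Δ x U ≤ dist x u := by
  unfold distTo
  rw [dif_pos ⟨u, hu⟩]
  exact Finset.inf'_le _ hu

theorem exists_distTo_eq (Δ : ℝ) (x : X) {U : Finset X} (hU : U.Nonempty) :
    ∃ u ∈ U, distTo Δ x U = dist x u := by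
  unfold distTo
  rw [dif_pos hU]
  exact Finset.exists_mem_eq_inf' hU _

theorem distTo_le_add_dist (Δ : ℝ) (x y : X) (U : Finset X) :
    distTo Δ x U ≤ distTo Δ y U + dist x y := by
  rcases U.eq_empty_or_nonempty with rfl | hU
  · simp [distTo]
  · obtain ⟨u, hu, h⟩ := exists_distTo_eq Δ y hU
    rw [h]
    linarith [distTo_le_dist (Δ := Δ) x hu, dist_triangle x y u]

theorem cost_nonneg {Δ : ℝ} (hΔ : 0 ≤ Δ) (U : Finset X) (W : List (X × ℕ)) : 0 ≤ cost Δ U W := by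
  refine List.sum_nonneg fun a ha => ?_
  obtain ⟨p, -, rfl⟩ := List.mem_map.1 ha
  exact mul_nonneg (Nat.cast_nonneg _) (distTo_nonneg hΔ _ _)

theorem cost_unitWeights (Δ : ℝ) (U : Finset X) (P : List X) :
    cost Δ U (unitWeights P) = (P.map fun x => distTo Δ x U).sum := by
  simp [cost, unitWeights, Function.comp_def]

theorem exists_cost_eq_opt (k : ℕ) (Δ : ℝ) (W : List (X × ℕ)) :
    ∃ U ∈ centerSets k W, opt k Δ W = cost Δ U W :=
  Finset.exists_mem_eq_inf' _ _

theorem opt_le_cost {k : ℕ} (Δ : ℝ) {W : List (X × ℕ)} {U : Finset X} (hU : U ∈ centerSets k W) :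
    opt k Δ W ≤ cost Δ U W :=
  Finset.inf'_le _ hU

theorem opt_nonneg (k : ℕ) {Δ : ℝ} (hΔ : 0 ≤ Δ) (W : List (X × ℕ)) : 0 ≤ opt k Δ W := by
  obtain ⟨U, -, h⟩ := exists_cost_eq_opt k Δ W
  rw [h]
  exact cost_nonneg hΔ U W

omit [PseudoMetricSpace X] in
theorem mem_centerSets {k : ℕ} {W : List (X × ℕ)} {U : Finset X} :
    U ∈ centerSets k W ↔ (∀ u ∈ U, ∃ p ∈ W, p.1 = u) ∧ U.card ≤ k := by
  classical
  simp only [centerSets, Finset.mem_filter, Finset.mem_powerset, Finset.subset_iff,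
    List.mem_toFinset, List.mem_map]

/-- Moving arbitrary centers to points of the instance at most doubles the cost. -/
theorem opt_le_two_mul_cost {k : ℕ} {Δ : ℝ} (hΔ : 0 ≤ Δ) (W : List (X × ℕ)) {U : Finset X}
    (hU : U.card ≤ k) : opt k Δ W ≤ 2 * cost Δ U W := by
  classical
  rcases W.eq_nil_or_concat' with rfl | ⟨W', p', hW⟩
  · have h := opt_le_cost (k := k) Δ (W := ([] : List (X × ℕ))) (U := ∅)
      (mem_centerSets.2 (by simp))
    simpa [cost] using h
  have hne : W.toFinset.Nonempty := ⟨p', by simp [hW]⟩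
  choose g hg hmin using fun u : X => Finset.exists_min_image W.toFinset (fun p => dist p.1 u) hne
  have hmem : U.image (fun u => (g u).1) ∈ centerSets k W := by
    refine mem_centerSets.2 ⟨fun v hv => ?_, Finset.card_image_le.trans hU⟩
    obtain ⟨u, -, rfl⟩ := Finset.mem_image.1 hv
    exact ⟨g u, by simpa using hg u, rfl⟩
  refine (opt_le_cost Δ hmem).trans ?_
  unfold cost
  rw [← List.sum_map_mul_left]
  refine List.sum_le_sum fun p hp => ?_
  -- If `u` is the center closest to `p`, its closest instance point `g u` is no farther from `u`
  -- than `p` itself.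
  have key : distTo Δ p.1 (U.image fun u => (g u).1) ≤ 2 * distTo Δ p.1 U := by
    rcases U.eq_empty_or_nonempty with rfl | hne
    · simp [distTo]
      linarith
    · obtain ⟨u, hu, h⟩ := exists_distTo_eq Δ p.1 hne
      rw [h]
      have h1 := hmin u p (by simpa using hp)
      have h2 := distTo_le_dist (Δ := Δ) p.1 (Finset.mem_image_of_mem (fun u => (g u).1) hu)
      have h3 := dist_triangle p.1 u (g u).1
      rw [dist_comm u] at h3
      linarith
  nlinarith [(Nat.cast_nonneg p.2 : (0 : ℝ) ≤ p.2)]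

/-- A weighted instance `W` represents the points `h` up to total movement `M`. -/
structure Represents (h : List X) (W : List (X × ℕ)) (M : ℝ) : Prop where
  subset : ∀ p ∈ W, p.1 ∈ h
  le_weighted : ∀ f : X → ℝ, (∀ x, 0 ≤ f x) → (∀ x y, f x ≤ f y + dist x y) →
    (h.map f).sum ≤ (W.map fun p => (p.2 : ℝ) * f p.1).sum + M
  weighted_le : ∀ f : X → ℝ, (∀ x, 0 ≤ f x) → (∀ x y, f x ≤ f y + dist x y) →
    (W.map fun p => (p.2 : ℝ) * f p.1).sum ≤ 2 * ((h.map f).sum + M)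

theorem Represents.mono {h : List X} {W : List (X × ℕ)} {M M' : ℝ} (H : Represents h W M)
    (hM : M ≤ M') : Represents h W M' where
  subset := H.subset
  le_weighted f h0 h1 := by linarith [H.le_weighted f h0 h1]
  weighted_le f h0 h1 := by linarith [H.weighted_le f h0 h1]

/-- The factor 2 is needed because optimal centers for `P ++ Q` may lie outside `P`, whereas
feasible centers must be instance points. -/
theorem opt_unitWeights_le_two_mul_append (k : ℕ) {Δ : ℝ} (hΔ : 0 ≤ Δ) (P Q : List X) :
    opt k Δ (unitWeights P) ≤ 2 * opt k Δ (unitWeights (P ++ Q)) := by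
  obtain ⟨U, hU, h⟩ := exists_cost_eq_opt k Δ (unitWeights (P ++ Q))
  have h1 := opt_le_two_mul_cost hΔ (unitWeights P) (mem_centerSets.1 hU).2
  have h2 : cost Δ U (unitWeights (P ++ Q)) =
      cost Δ U (unitWeights P) + cost Δ U (unitWeights Q) := by
    simp [cost, unitWeights]
  linarith [cost_nonneg hΔ U (unitWeights Q)]

/-- Both directions of `Represents` are used: `le_weighted` with the distance to the given `U`, and
`weighted_le` with the distance to an optimal `V` for the original points, which bounds `opt k Δ W`.
-/
theorem Represents.isApproxSolution {k : ℕ} {Δ G M α : ℝ} (hΔ : 0 ≤ Δ) {P Q : List X}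
    {W : List (X × ℕ)} {U : Finset X} (H : Represents (P ++ Q) W M) (hM : M ≤ 292 * G)
    (hG : G ≤ 3 * opt k Δ (unitWeights P)) (hα : 0 ≤ α) (hU : IsApproxSolution k Δ α U W) :
    IsApproxSolution k Δ (7012 * (α + 1)) U (unitWeights (P ++ Q)) := by
  obtain ⟨hU1, hU2⟩ := hU
  obtain ⟨hUW, hUk⟩ := mem_centerSets.1 hU1
  refine ⟨mem_centerSets.2 ⟨fun u hu => ?_, hUk⟩, ?_⟩
  · obtain ⟨p, hp, rfl⟩ := hUW u hu
    exact ⟨(p.1, 1), List.mem_map.2 ⟨p.1, H.subset p hp, rfl⟩, rfl⟩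
  have hP := opt_unitWeights_le_two_mul_append k hΔ P Q
  obtain ⟨V, hV, hopt⟩ := exists_cost_eq_opt k Δ (unitWeights (P ++ Q))
  have h1 := H.le_weighted (fun x => distTo Δ x U) (fun x => distTo_nonneg hΔ x U)
    (fun x y => distTo_le_add_dist Δ x y U)
  have h2 := H.weighted_le (fun x => distTo Δ x V) (fun x => distTo_nonneg hΔ x V)
    (fun x y => distTo_le_add_dist Δ x y V)
  rw [← cost_unitWeights] at h1 h2
  change _ ≤ cost Δ U W + M at h1
  change cost Δ V W ≤ _ at h2
  have h3 := opt_le_two_mul_cost hΔ W (mem_centerSets.1 hV).2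
  have h0 := opt_nonneg k hΔ (unitWeights (P ++ Q))
  -- Here `M ≤ 292 * 3 * 2 * OPT = 1752 * OPT`, so the optimum of `W` is at most `2 * 2 * (1 + 1752)
  -- * OPT`.
  have h4 : opt k Δ W ≤ 7012 * opt k Δ (unitWeights (P ++ Q)) := by linarith
  nlinarith [mul_le_mul_of_nonneg_left h4 hα]

/-! ### The failure probability of a single copy -/

/-- The distance from `x` to the open centers, in multiples of the facility cost. -/
def scaledDist (k : ℕ) (Δ G : ℝ) (S : List X) (x : X) : ℝ≥0∞ :=
  (⨅ y ∈ S, edist x y) * ENNReal.ofReal (k * (Real.logb 2 Δ + 1)) / ENNReal.ofReal G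

theorem openProb_eq_min (k : ℕ) (Δ G : ℝ) (S : List X) (x : X) :
    openProb k Δ G S x = min 1 (scaledDist k Δ G S x) := rfl

/-- The charge of a step: `1` for opening a center, the scaled distance otherwise. -/
def charge (k : ℕ) (Δ G : ℝ) (S : List X) (x : X) (b : Bool) : ℝ≥0∞ :=
  if b then 1 else scaledDist k Δ G S x

/-- The probability that a single copy with open centers `S` and accumulated charge `a` ends with
a total charge above the budget after it has read a list of points. -/
def failProb (k : ℕ) (Δ G : ℝ) : List X → ℝ≥0∞ → List X → ℝ≥0∞
  | _, a, [] => if a ≤ ENNReal.ofReal (292 * k * (Real.logb 2 Δ + 1)) then 0 else 1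
  | S, a, x :: xs =>
    openProb k Δ G S x * failProb k Δ G (x :: S) (a + charge k Δ G S x true) xs +
      (1 - openProb k Δ G S x) * failProb k Δ G S (a + charge k Δ G S x false) xs

open Classical in
/-- The number of labels in `T` that no point of `S` carries. -/
def unhit {L : Type*} (T : Finset L) (label : X → L) (S : List X) : ℕ :=
  (T.filter fun l => ∀ y ∈ S, label y ≠ l).card

omit [PseudoMetricSpace X] in
theorem unhit_cons_le {L : Type*} (T : Finset L) (label : X → L) (S : List X) (x : X) :
    unhit T label (x :: S) ≤ unhit T label S := by
  classical
  refine Finset.card_le_card fun l hl => ?_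
  simp only [Finset.mem_filter, List.mem_cons, forall_eq_or_imp] at hl ⊢
  exact ⟨hl.1, hl.2.2⟩

omit [PseudoMetricSpace X] in
theorem unhit_cons_lt {L : Type*} {T : Finset L} {label : X → L} {S : List X} {x : X}
    (hx : label x ∈ T) (hS : ∀ y ∈ S, label y ≠ label x) :
    unhit T label (x :: S) + 1 ≤ unhit T label S := by
  classical
  refine Finset.card_lt_card (Finset.ssubset_iff_subset_ne.2 ⟨fun l hl => ?_, fun h => ?_⟩)
  · simp only [Finset.mem_filter, List.mem_cons, forall_eq_or_imp] at hl ⊢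
    exact ⟨hl.1, hl.2.2⟩
  · have h2 : label x ∈ T.filter fun l => ∀ y ∈ S, label y ≠ l := by simpa [hx] using hS
    rw [← h] at h2
    simp at h2

/-- One step of the potential argument: `V₁` and `V₂` are the potentials after opening and not
opening, and the expected charge is at most `2 * p`. Either opening lowers the potential by 2, which
pays for this, or the scaled distance `s` is small enough to be paid directly. -/
theorem mul_add_one_sub_mul_le {p s V₁ V₂ R : ℝ≥0∞} (hp : p = min 1 s)
    (h : V₁ + 1 + 1 ≤ R ∨ 2 * s + V₂ ≤ R ∧ V₁ ≤ V₂) (h2 : V₂ ≤ R) :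
    p * (1 + V₁) + (1 - p) * (s + V₂) ≤ R := by
  have hp1 : p ≤ 1 := hp ▸ min_le_left _ _
  have hps : p ≤ s := hp ▸ min_le_right _ _
  have hsum : p + (1 - p) = 1 := add_tsub_cancel_of_le hp1
  -- If `s ≥ 1` the point is opened surely; this covers `s = ∞`, where the product is `0 * ∞ = 0`.
  have hs : (1 - p) * s ≤ p := by
    rcases le_total 1 s with h1 | h1
    · simp [hp, min_eq_left h1]
    · rw [hp, min_eq_right h1]
      exact mul_le_of_le_one_left zero_le tsub_le_self
  rcases h with h | ⟨h, h12⟩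
  · calc p * (1 + V₁) + (1 - p) * (s + V₂)
        = p * (1 + V₁) + (1 - p) * s + (1 - p) * V₂ := by ring
      _ ≤ p * (1 + V₁) + p + (1 - p) * R := by gcongr
      _ = p * (V₁ + 1 + 1) + (1 - p) * R := by ring
      _ ≤ p * R + (1 - p) * R := by gcongr
      _ = R := by rw [← add_mul, hsum, one_mul]
  · calc p * (1 + V₁) + (1 - p) * (s + V₂)
        = p + (1 - p) * s + (p * V₁ + (1 - p) * V₂) := by ring
      _ ≤ s + s + (p * V₂ + (1 - p) * V₂) := by gcongr; exact hs.trans hps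
      _ = 2 * s + V₂ := by rw [← add_mul, hsum, one_mul, two_mul]
      _ ≤ R := h

/-- Markov's inequality, with the expected charge bounded by a potential. Each label without a
center holds 2 units, which pay for the expected charge until its first center opens. Afterwards a
point of that label is within `3 * d x` of a center and pays at most 6 times its scaled `d x`. -/
theorem failProb_le {L : Type*} (k : ℕ) (Δ G : ℝ)
    (hB : 0 < 292 * k * (Real.logb 2 Δ + 1)) (T : Finset L) (label : X → L)
    (d : X → ℝ≥0∞) (D : List X) (hT : ∀ x ∈ D, label x ∈ T)
    (hd : ∀ x ∈ D, ∀ y ∈ D, label x = label y → edist x y ≤ 3 * d x)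
    (xs : List X) : ∀ (S : List X) (a : ℝ≥0∞), xs ⊆ D → S ⊆ D →
      failProb k Δ G S a xs ≤ (a + (2 * unhit T label S + (xs.map fun x =>
        6 * (d x * ENNReal.ofReal (k * (Real.logb 2 Δ + 1)) / ENNReal.ofReal G)).sum)) /
          ENNReal.ofReal (292 * k * (Real.logb 2 Δ + 1)) := by
  have hB0 : ENNReal.ofReal (292 * k * (Real.logb 2 Δ + 1)) ≠ 0 :=
    (ENNReal.ofReal_pos.2 hB).ne'
  induction xs with
  | nil =>
    intro S a _ _
    unfold failProb
    split_ifs with h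
    · exact zero_le
    · rw [ENNReal.le_div_iff_mul_le (Or.inl hB0) (Or.inl ENNReal.ofReal_ne_top), one_mul]
      exact (not_le.1 h).le.trans le_self_add
  | cons x xs ih =>
    intro S a hxs hS
    obtain ⟨hx, hxs⟩ := List.cons_subset.1 hxs
    unfold failProb
    refine (add_le_add (mul_le_mul_right (ih (x :: S) _ hxs (List.cons_subset.2 ⟨hx, hS⟩)) _)
      (mul_le_mul_right (ih S _ hxs hS) _)).trans ?_
    rw [← mul_div_assoc, ← mul_div_assoc, ENNReal.div_add_div_same]
    refine ENNReal.div_le_div_right ?_ _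
    simp only [charge, List.map_cons, List.sum_cons, if_true, Bool.false_eq_true, if_false]
    set p := openProb k Δ G S x
    set s := scaledDist k Δ G S x with hs
    set R := (xs.map fun x =>
        6 * (d x * ENNReal.ofReal (k * (Real.logb 2 Δ + 1)) / ENNReal.ofReal G)).sum
    set e := d x * ENNReal.ofReal (k * (Real.logb 2 Δ + 1)) / ENNReal.ofReal G with he
    have hp1 : p ≤ 1 := openProb_le_one k Δ G S x
    have hsum : p + (1 - p) = 1 := add_tsub_cancel_of_le hp1
    have hle : (unhit T label (x :: S) : ℝ≥0∞) ≤ unhit T label S := by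
      exact_mod_cast unhit_cons_le T label S x
    have key : p * (1 + 2 * unhit T label (x :: S)) + (1 - p) * (s + 2 * unhit T label S) ≤
        2 * unhit T label S + 6 * e := by
      refine mul_add_one_sub_mul_le (openProb_eq_min k Δ G S x) ?_ le_self_add
      by_cases hit : ∃ y ∈ S, label y = label x
      · obtain ⟨y, hy, hyx⟩ := hit
        have h1 : s ≤ 3 * e := by
          rw [hs, he, scaledDist, ← mul_div_assoc, ← mul_assoc]
          refine ENNReal.div_le_div_right (mul_le_mul_left ?_ _) _
          exact (iInf₂_le y hy).trans (hd x hx y (hS hy) hyx.symm)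
        refine Or.inr ⟨?_, by gcongr⟩
        calc 2 * s + 2 * (unhit T label S : ℝ≥0∞)
            ≤ 2 * (3 * e) + 2 * unhit T label S := by gcongr
          _ = 2 * unhit T label S + 6 * e := by ring
      · push Not at hit
        left
        have h1 : (unhit T label (x :: S) : ℝ≥0∞) + 1 ≤ unhit T label S := by
          exact_mod_cast unhit_cons_lt (hT x hx) hit
        calc 2 * (unhit T label (x :: S) : ℝ≥0∞) + 1 + 1
            = 2 * ((unhit T label (x :: S) : ℝ≥0∞) + 1) := by ring
          _ ≤ 2 * unhit T label S := by gcongr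
          _ ≤ _ := le_self_add
    calc p * (a + 1 + (2 * unhit T label (x :: S) + R)) +
          (1 - p) * (a + s + (2 * unhit T label S + R))
        = (p + (1 - p)) * (a + R) + (p * (1 + 2 * unhit T label (x :: S)) +
          (1 - p) * (s + 2 * unhit T label S)) := by ring
      _ ≤ 1 * (a + R) + (2 * unhit T label S + 6 * e) := by rw [hsum]; gcongr
      _ = a + (2 * unhit T label S + (6 * e + R)) := by ring

/-- The points split into few groups, such that distances within a group are bounded by the
distances to the optimal centers: one group for each optimal center and each scale. -/
theorem exists_labels {k : ℕ} {Δ : ℝ} (hk : 1 ≤ k) (hΔ : 1 ≤ Δ) (D : List X)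
    (hD : ∀ x ∈ D, ∀ y ∈ D, dist x y = 0 ∨ (1 ≤ dist x y ∧ dist x y ≤ Δ)) :
    ∃ (label : X → X × ℕ) (T : Finset (X × ℕ)) (d : X → ℝ),
      (∀ x ∈ D, label x ∈ T) ∧ (T.card : ℝ) ≤ 2 * (k * (Real.logb 2 Δ + 1)) ∧
      (∀ x, 0 ≤ d x) ∧ (∀ x ∈ D, ∀ y ∈ D, label x = label y → dist x y ≤ 3 * d x) ∧
      (D.map d).sum = opt k Δ (unitWeights D) := by
  classical
  have hlog : 0 ≤ Real.logb 2 Δ := Real.logb_nonneg (by norm_num) hΔ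
  have hk' : (1 : ℝ) ≤ k := by exact_mod_cast hk
  obtain ⟨U, hU, hopt⟩ := exists_cost_eq_opt k Δ (unitWeights D)
  obtain ⟨hUD, hUk⟩ := mem_centerSets.1 hU
  have hUD' : ∀ u ∈ U, u ∈ D := by
    intro u hu
    obtain ⟨p, hp, rfl⟩ := hUD u hu
    obtain ⟨x, hx, rfl⟩ := List.mem_map.1 hp
    exact hx
  rw [cost_unitWeights] at hopt
  rcases U.eq_empty_or_nonempty with rfl | hne
  -- With no centers every point costs the default `Δ`, which bounds all distances, so a single
  -- label suffices.
  · rcases D.eq_nil_or_concat' with rfl | ⟨D', x₀, hD'⟩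
    · refine ⟨fun x => (x, 0), ∅, fun _ => 0, by simp, ?_, by simp, by simp, ?_⟩
      · simp only [Finset.card_empty, Nat.cast_zero]
        positivity
      · simpa using hopt.symm
    · refine ⟨fun _ => (x₀, 0), {(x₀, 0)}, fun x => distTo Δ x ∅, by simp, ?_,
        fun x => distTo_nonneg (by linarith) x _, ?_, hopt.symm⟩
      · simp only [Finset.card_singleton, Nat.cast_one]
        nlinarith
      · intro x hx y hy _
        simp only [distTo, Finset.not_nonempty_empty, dif_neg, not_false_eq_true]
        rcases hD x hx y hy with h | h <;> linarith
  choose c hcU hc using fun x : X => exists_distTo_eq Δ x hne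
  -- Scale 0 is reserved for distance zero; the dyadic scales of distances in `[1, Δ]` are shifted
  -- by one. This gives `⌊log₂ Δ⌋ + 2` scales in all.
  let r : ℝ → ℕ := fun t => if t = 0 then 0 else ⌊Real.logb 2 t⌋₊ + 1
  refine ⟨fun x => (c x, r (dist x (c x))), U ×ˢ Finset.range (⌊Real.logb 2 Δ⌋₊ + 2),
    fun x => distTo Δ x U, fun x hx => ?_, ?_, fun x => distTo_nonneg (by linarith) x _, ?_,
    hopt.symm⟩
  · refine Finset.mem_product.2 ⟨hcU x, Finset.mem_range.2 ?_⟩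
    simp only [r]
    split_ifs with h
    · omega
    · rcases hD x hx _ (hUD' _ (hcU x)) with h' | h'
      · exact absurd h' h
      · have := Nat.floor_le_floor
          (Real.logb_le_logb_of_le (b := 2) (by norm_num) (by linarith [h'.1]) h'.2)
        omega
  · rw [Finset.card_product, Finset.card_range]
    push_cast
    have h1 : (U.card : ℝ) ≤ k := by exact_mod_cast hUk
    have h2 := Nat.floor_le hlog
    calc (U.card : ℝ) * (⌊Real.logb 2 Δ⌋₊ + 2) ≤ k * (Real.logb 2 Δ + 2) := by gcongr
      _ ≤ 2 * (k * (Real.logb 2 Δ + 1)) := by nlinarith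
  · intro x hx y hy hxy
    simp only [Prod.mk.injEq] at hxy
    obtain ⟨hcc, hr⟩ := hxy
    change dist x y ≤ 3 * distTo Δ x U
    rw [hc x]
    have htri := dist_triangle x (c x) y
    rw [dist_comm (c x) y] at htri
    rw [← hcc] at hr
    have hx' := hD x hx _ (hUD' _ (hcU x))
    have hy' := hD y hy _ (hUD' _ (hcU x))
    simp only [r] at hr
    split_ifs at hr with h1 h2 h2
    · linarith
    · have hx1 := (hx'.resolve_left h1).1
      have hy1 := (hy'.resolve_left h2).1
      have hf : ⌊Real.logb 2 (dist x (c x))⌋₊ = ⌊Real.logb 2 (dist y (c x))⌋₊ := by omega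
      have h3 := Nat.floor_le (Real.logb_nonneg (b := 2) (by norm_num) hx1)
      have h4 := Nat.lt_floor_add_one (Real.logb 2 (dist y (c x)))
      rw [← hf] at h4
      -- Equal scales give `dist y (c x) ≤ 2 * dist x (c x)`; the triangle inequality then yields
      -- the factor 3.
      have h5 : Real.logb 2 (dist y (c x)) ≤ Real.logb 2 (2 * dist x (c x)) := by
        rw [Real.logb_mul (by norm_num) h1, Real.logb_self_eq_one (by norm_num)]
        linarith
      have h6 := (Real.logb_le_logb (by norm_num) (by linarith) (by linarith)).1 h5
      linarith

/-- The initial potential is at most `2 * 2K + 6 * 18K = 112K`, below half of the budget `292K`. -/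
theorem failProb_nil_le_half {k : ℕ} {Δ G : ℝ} (hk : 1 ≤ k) (hΔ : 1 ≤ Δ) (D : List X)
    (hD : ∀ x ∈ D, ∀ y ∈ D, dist x y = 0 ∨ (1 ≤ dist x y ∧ dist x y ≤ Δ))
    (hG : opt k Δ (unitWeights D) ≤ 18 * G) :
    failProb k Δ G [] 0 D ≤ 2⁻¹ := by
  obtain ⟨label, T, d, hT, hcard, hd0, hd, hsum⟩ := exists_labels hk hΔ D hD
  have hlog : 0 ≤ Real.logb 2 Δ := Real.logb_nonneg (by norm_num) hΔ
  have hk' : (1 : ℝ) ≤ k := by exact_mod_cast hk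
  have hK : 0 < k * (Real.logb 2 Δ + 1) := by positivity
  have hB : 0 < 292 * k * (Real.logb 2 Δ + 1) := by positivity
  refine (failProb_le k Δ G hB T label (fun x => ENNReal.ofReal (d x)) D hT ?_ D [] 0
    (List.Subset.refl _) (List.nil_subset _)).trans ?_
  · intro x hx y hy hxy
    rw [edist_dist, show (3 : ℝ≥0∞) = ENNReal.ofReal 3 by simp,
      ← ENNReal.ofReal_mul (by norm_num)]
    exact ENNReal.ofReal_le_ofReal (hd x hx y hy hxy)
  set K := k * (Real.logb 2 Δ + 1) with hKdef
  have hunhit : (unhit T label [] : ℝ≥0∞) ≤ ENNReal.ofReal (2 * K) := by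
    rw [← ENNReal.ofReal_natCast]
    refine ENNReal.ofReal_le_ofReal (le_trans ?_ hcard)
    classical
    exact_mod_cast Finset.card_filter_le _ _
  have hcost : (D.map fun x => 6 * (ENNReal.ofReal (d x) * ENNReal.ofReal K /
      ENNReal.ofReal G)).sum ≤ 6 * ENNReal.ofReal (18 * K) := by
    have h1 : (D.map fun x => 6 * (ENNReal.ofReal (d x) * ENNReal.ofReal K /
        ENNReal.ofReal G)).sum =
        6 * (ENNReal.ofReal (D.map d).sum * ENNReal.ofReal K / ENNReal.ofReal G) := by
      clear hT hd hsum hD hG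
      induction D with
      | nil => simp
      | cons x D ih =>
        rw [List.map_cons, List.sum_cons, ih, List.map_cons, List.sum_cons, ENNReal.ofReal_add
          (hd0 x) (List.sum_nonneg (by simpa using fun a _ => hd0 a)), add_mul,
          ENNReal.add_div, mul_add]
    rw [h1, hsum]
    refine mul_le_mul_right ?_ _
    calc ENNReal.ofReal (opt k Δ (unitWeights D)) * ENNReal.ofReal K / ENNReal.ofReal G
        ≤ ENNReal.ofReal (18 * G) * ENNReal.ofReal K / ENNReal.ofReal G := by gcongr
      _ = ENNReal.ofReal (18 * K) * (ENNReal.ofReal G / ENNReal.ofReal G) := by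
          rw [ENNReal.ofReal_mul (p := 18) (q := G) (by norm_num),
            ENNReal.ofReal_mul (p := 18) (q := K) (by norm_num), ← mul_div_assoc]
          congr 1
          ring
      -- An inequality rather than an equality, since `G = 0` gives `0 / 0 = 0`.
      _ ≤ ENNReal.ofReal (18 * K) * 1 := by gcongr; exact ENNReal.div_self_le_one
      _ = _ := mul_one _
  rw [ENNReal.div_le_iff_le_mul (Or.inl (ENNReal.ofReal_pos.2 hB).ne') (Or.inl ENNReal.ofReal_ne_top),
    zero_add]
  refine (add_le_add (mul_le_mul_right hunhit 2) hcost).trans ?_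
  rw [show (6 : ℝ≥0∞) = ENNReal.ofReal 6 by simp, show (2 : ℝ≥0∞) = ENNReal.ofReal 2 by simp,
    ← ENNReal.ofReal_inv_of_pos (by norm_num), ← ENNReal.ofReal_mul (by norm_num),
    ← ENNReal.ofReal_mul (by norm_num), ← ENNReal.ofReal_mul (by norm_num),
    ← ENNReal.ofReal_add (by positivity) (by positivity)]
  refine ENNReal.ofReal_le_ofReal ?_
  rw [mul_assoc 292, ← hKdef]
  linarith

/-! ### One step of the procedure -/

/-- The centers after the copies `i` with `b i = true` opened `x`. -/
def openCenters (c : Fin q → List X) (x : X) (b : Fin q → Bool) (i : Fin q) : List X :=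
  if b i then x :: c i else c i

/-- Some copy that opens `x` is still within its budget of centers. -/
def Opens (k : ℕ) (Δ : ℝ) (s : State X q) (x : X) (b : Fin q → Bool) : Prop :=
  ∃ i, b i = true ∧
    ((openCenters s.centers x b i).length : ℝ) ≤ 292 * k * (Real.logb 2 Δ + 1)

theorem nearest_eq_none {x : X} {L : List (X × ℕ)} : nearest x L = none ↔ L = [] := by
  unfold nearest
  rw [List.argmin_eq_none]
  cases L <;> simp [List.finRange_succ]

theorem dist_le_of_nearest {x : X} {L : List (X × ℕ)} {r : Fin L.length}
    (h : nearest x L = some r) {p : X × ℕ} (hp : p ∈ L) : dist x (L.get r).1 ≤ dist x p.1 := by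
  obtain ⟨j, rfl⟩ := List.get_of_mem hp
  exact List.le_of_mem_argmin (f := fun r => dist x (L.get r).1) (List.mem_finRange j) h

/-- What a step does to sketch and transcript when `x` is assigned to a point `y` of weight `w`. -/
structure IsAssignment (s s' : State X q) (x y : X) (w : ℕ) (o : Option (X × ℕ)) : Prop where
  mem : (y, w) ∈ s.sketch
  dist_le : ∀ p ∈ s.sketch, dist x y ≤ dist x p.1
  length : s'.sketch.length = s.sketch.length
  sum : ∀ g : X × ℕ → ℝ,
    (s'.sketch.map g).sum = (s.sketch.map g).sum + (g (y, w + 1) - g (y, w))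
  mem_or : ∀ p ∈ s'.sketch, p ∈ s.sketch ∨ p = (y, w + 1)
  exists_mem : ∀ p ∈ s.sketch, ∃ p' ∈ s'.sketch, p'.1 = p.1
  transcript : s'.transcript = s.transcript ++ [o]
  out : ((∃ l : ℕ, w + 1 = 2 ^ l) ∧ o = some (y, w + 1)) ∨ (¬ (∃ l : ℕ, w + 1 = 2 ^ l) ∧ o = none)

theorem update_centers (k : ℕ) (Δ : ℝ) (s : State X q) (x : X) (b : Fin q → Bool) :
    (update k Δ s x b).centers = openCenters s.centers x b := by
  unfold update
  simp only
  split_ifs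
  · rfl
  · split <;> rfl

/-- The coins `b` are arbitrary here, so an empty sketch with nothing opened must be allowed for. -/
theorem update_cases (k : ℕ) (Δ : ℝ) (s : State X q) (x : X) (b : Fin q → Bool) :
    (Opens k Δ s x b ∧ (update k Δ s x b).sketch = s.sketch ++ [(x, 1)] ∧
      (update k Δ s x b).transcript = s.transcript ++ [some (x, 1)]) ∨
    (¬ Opens k Δ s x b ∧ s.sketch = [] ∧ (update k Δ s x b).sketch = [] ∧
      (update k Δ s x b).transcript = s.transcript ++ [none]) ∨
    (¬ Opens k Δ s x b ∧ ∃ y w o, IsAssignment s (update k Δ s x b) x y w o) := by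
  by_cases h : Opens k Δ s x b
  · left
    have h' := h
    unfold Opens openCenters at h'
    refine ⟨h, ?_, ?_⟩ <;> unfold update <;> simp only [if_pos h']
  right
  have h' := h
  unfold Opens openCenters at h'
  cases hn : nearest x s.sketch with
  | none =>
    left
    have hnil := nearest_eq_none.1 hn
    refine ⟨h, hnil, ?_, ?_⟩
    · unfold update
      simp only [if_neg h', hn]
      exact hnil
    · unfold update
      simp only [if_neg h', hn]
  | some r =>
    right
    classical
    have hsk : (update k Δ s x b).sketch =
        s.sketch.set r ((s.sketch.get r).1, (s.sketch.get r).2 + 1) := by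
      unfold update
      simp only [if_neg h', hn]
    have hlt : (r : ℕ) < s.sketch.length := r.2
    refine ⟨h, (s.sketch.get r).1, (s.sketch.get r).2,
      if ∃ l : ℕ, (s.sketch.get r).2 + 1 = 2 ^ l then
        some ((s.sketch.get r).1, (s.sketch.get r).2 + 1) else none,
      List.get_mem _ _, fun p hp => dist_le_of_nearest hn hp, by simp [hsk],
      fun g => ?_, fun p hp => ?_, fun p hp => ?_, ?_, ?_⟩
    · rw [hsk, List.map_set, List.sum_set', dif_pos (by simp)]
      simp only [List.getElem_map, List.get_eq_getElem]
      ring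
    · rw [hsk] at hp
      exact List.mem_or_eq_of_mem_set hp
    · obtain ⟨j, hj, rfl⟩ := List.getElem_of_mem hp
      refine ⟨(update k Δ s x b).sketch[j]'(by simpa [hsk] using hj), List.getElem_mem _, ?_⟩
      simp only [hsk, List.getElem_set]
      split_ifs with hjr
      · subst hjr
        rfl
      · rfl
    · unfold update
      simp only [if_neg h', hn]
    · by_cases hl : ∃ l : ℕ, (s.sketch.get r).2 + 1 = 2 ^ l
      · exact Or.inl ⟨hl, if_pos hl⟩
      · exact Or.inr ⟨hl, if_neg hl⟩

/-! ### Invariants -/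

/-- The sum of the powers of two up to `w`. -/
def outputWeight (w : ℕ) : ℕ := 2 ^ (Nat.log 2 w + 1) - 1

theorem le_outputWeight (w : ℕ) : w ≤ outputWeight w :=
  Nat.le_sub_one_of_lt (Nat.lt_pow_succ_log_self (by norm_num) w)

theorem outputWeight_le {w : ℕ} (hw : 0 < w) : outputWeight w ≤ 2 * w := by
  have := Nat.pow_log_le_self 2 hw.ne'
  unfold outputWeight
  rw [pow_succ]
  omega

theorem log_succ_of_eq_pow {w l : ℕ} (hw : 0 < w) (h : w + 1 = 2 ^ l) :
    Nat.log 2 (w + 1) = Nat.log 2 w + 1 := by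
  rw [h, Nat.log_pow (by norm_num)]
  obtain _ | l := l
  · omega
  · congr 1
    symm
    rw [Nat.log_eq_iff (Or.inr ⟨by norm_num, hw.ne'⟩)]
    have : 0 < 2 ^ l := by positivity
    rw [pow_succ] at h ⊢
    omega

theorem log_succ_of_ne_pow {w : ℕ} (hw : 0 < w) (h : ¬ ∃ l : ℕ, w + 1 = 2 ^ l) :
    Nat.log 2 (w + 1) = Nat.log 2 w := by
  rw [Nat.log_eq_iff (Or.inr ⟨by norm_num, by omega⟩)]
  have h1 := Nat.pow_log_le_self 2 hw.ne'
  have h2 := Nat.lt_pow_succ_log_self (b := 2) (by norm_num) w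
  have h3 : w + 1 ≠ 2 ^ (Nat.log 2 w + 1) := fun h' => h ⟨_, h'⟩
  omega

theorem outputWeight_succ_of_eq_pow {w l : ℕ} (hw : 0 < w) (h : w + 1 = 2 ^ l) :
    outputWeight (w + 1) = outputWeight w + (w + 1) := by
  unfold outputWeight
  have h1 := log_succ_of_eq_pow hw h
  have h2 : w + 1 = 2 ^ (Nat.log 2 w + 1) := by
    rw [← h1, h, Nat.log_pow (by norm_num)]
  rw [h1, pow_succ 2 (Nat.log 2 w + 1), ← h2]
  omega

theorem outputWeight_succ_of_ne_pow {w : ℕ} (hw : 0 < w) (h : ¬ ∃ l : ℕ, w + 1 = 2 ^ l) :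
    outputWeight (w + 1) = outputWeight w := by
  unfold outputWeight
  rw [log_succ_of_ne_pow hw h]

/-- What holds after every run that reads `h`, whatever the coins show. -/
structure Consistent (k : ℕ) (Δ : ℝ) (h : List X) (s : State X q) : Prop where
  length : s.transcript.length = h.length
  sketch : ∀ p ∈ s.sketch, 0 < p.2 ∧ p.1 ∈ h
  output : ∀ p ∈ s.transcript.reduceOption, 0 < p.2 ∧ p.1 ∈ h
  weights : ∀ f : X → ℝ, (s.transcript.reduceOption.map fun p => (p.2 : ℝ) * f p.1).sum =
    (s.sketch.map fun p => (outputWeight p.2 : ℝ) * f p.1).sum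
  count : (s.transcript.reduceOption.length : ℝ) =
    (s.sketch.map fun p => ((Nat.log 2 p.2 + 1 : ℕ) : ℝ)).sum
  total : (s.sketch.map fun p => (p.2 : ℝ)).sum ≤ h.length
  size : (s.sketch.length : ℝ) ≤
    ∑ i, min ((s.centers i).length : ℝ) (292 * k * (Real.logb 2 Δ + 1))

omit [PseudoMetricSpace X] in
theorem Consistent.init {k : ℕ} {Δ : ℝ} (hΔ : 1 ≤ Δ) :
    Consistent k Δ [] (State.init X q) where
  length := rfl
  sketch := by simp [State.init]
  output := by simp [State.init]
  weights := by simp [State.init]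
  count := by simp [State.init]
  total := by simp [State.init]
  size := by
    have := Real.logb_nonneg (b := 2) (by norm_num) hΔ
    simp only [State.init, List.length_nil, Nat.cast_zero]
    exact Finset.sum_nonneg fun i _ => le_min le_rfl (by positivity)

omit [PseudoMetricSpace X] in
theorem length_le_length_openCenters (c : Fin q → List X) (x : X) (b : Fin q → Bool) (i : Fin q) :
    (c i).length ≤ (openCenters c x b i).length := by
  unfold openCenters
  split_ifs <;> simp

theorem Consistent.update {k : ℕ} {Δ : ℝ} {h : List X} {s : State X q}
    (H : Consistent k Δ h s) (x : X) (b : Fin q → Bool) :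
    Consistent k Δ (h ++ [x]) (update k Δ s x b) := by
  have hmono : ∀ i, min ((s.centers i).length : ℝ) (292 * k * (Real.logb 2 Δ + 1)) ≤
      min ((openCenters s.centers x b i).length : ℝ) (292 * k * (Real.logb 2 Δ + 1)) := fun i =>
    min_le_min (by exact_mod_cast length_le_length_openCenters s.centers x b i) le_rfl
  have hsize := H.size.trans (Finset.sum_le_sum fun i _ => hmono i)
  rcases update_cases k Δ s x b with ⟨hO, hs, ht⟩ | ⟨-, hs0, hs, ht⟩ | ⟨-, y, w, o, hA⟩
  · constructor
    · simp [ht, H.length]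
    · intro p hp
      rw [hs, List.mem_append, List.mem_singleton] at hp
      rcases hp with hp | rfl
      · exact ⟨(H.sketch p hp).1, List.mem_append_left _ (H.sketch p hp).2⟩
      · simp
    · intro p hp
      rw [ht, List.reduceOption_append, List.mem_append] at hp
      rcases hp with hp | hp
      · exact ⟨(H.output p hp).1, List.mem_append_left _ (H.output p hp).2⟩
      · obtain rfl : p = (x, 1) := by simpa [List.reduceOption] using hp
        simp
    · intro f
      rw [ht, hs, List.reduceOption_append, List.map_append, List.map_append, List.sum_append,
        List.sum_append, H.weights f]
      simp [List.reduceOption, show outputWeight 1 = 1 by simp [outputWeight]]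
    · rw [ht, hs, List.reduceOption_append, List.map_append, List.length_append, Nat.cast_add,
        List.sum_append, H.count]
      simp [List.reduceOption]
    · rw [hs]
      simpa using H.total
    · rw [hs, update_centers]
      obtain ⟨i, hbi, hi⟩ := hO
      -- The opening copy is still within the budget, so its truncated number of centers grows by
      -- one and pays for the new sketch point.
      have hstrict : min ((s.centers i).length : ℝ) (292 * k * (Real.logb 2 Δ + 1)) + 1 ≤
          min ((openCenters s.centers x b i).length : ℝ) (292 * k * (Real.logb 2 Δ + 1)) := by
        rw [min_eq_left hi]
        have : (openCenters s.centers x b i).length = (s.centers i).length + 1 := by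
          simp [openCenters, hbi]
        rw [this]
        push_cast
        linarith [min_le_left ((s.centers i).length : ℝ) (292 * k * (Real.logb 2 Δ + 1))]
      have h1 := H.size
      rw [← Finset.add_sum_erase _ _ (Finset.mem_univ i)] at h1 ⊢
      have h2 := Finset.sum_le_sum (s := Finset.univ.erase i) fun j _ => hmono j
      simp only [List.length_append, List.length_singleton, Nat.cast_add, Nat.cast_one]
      linarith
  · have hr : (s.transcript ++ [none]).reduceOption = s.transcript.reduceOption := by
      simp [List.reduceOption_append]
    constructor
    · simp [ht, H.length]
    · simp [hs]
    · intro p hp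
      rw [ht, hr] at hp
      exact ⟨(H.output p hp).1, List.mem_append_left _ (H.output p hp).2⟩
    · intro f
      rw [ht, hr, H.weights f, hs, hs0]
    · rw [ht, hr, H.count, hs, hs0]
    · rw [hs, List.length_append]
      simp only [List.map_nil, List.sum_nil]
      positivity
    · rw [hs, update_centers, ← hs0]
      exact hsize
  · obtain ⟨hw, hy⟩ := H.sketch _ hA.mem
    simp only at hw hy
    constructor
    · simp [hA.transcript, H.length]
    · intro p hp
      rcases hA.mem_or p hp with hp | rfl
      · exact ⟨(H.sketch p hp).1, List.mem_append_left _ (H.sketch p hp).2⟩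
      · exact ⟨Nat.succ_pos _, List.mem_append_left _ hy⟩
    · intro p hp
      rw [hA.transcript, List.reduceOption_append, List.mem_append] at hp
      rcases hp with hp | hp
      · exact ⟨(H.output p hp).1, List.mem_append_left _ (H.output p hp).2⟩
      · rcases hA.out with ⟨-, ho⟩ | ⟨-, ho⟩
        · obtain rfl : p = (y, w + 1) := by simpa [List.reduceOption, ho] using hp
          exact ⟨Nat.succ_pos _, List.mem_append_left _ hy⟩
        · simp [List.reduceOption, ho] at hp
    · intro f
      rw [hA.transcript, hA.sum, List.reduceOption_append, List.map_append, List.sum_append,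
        H.weights f]
      congr 1
      rcases hA.out with ⟨⟨l, hl⟩, ho⟩ | ⟨hl, ho⟩
      · rw [outputWeight_succ_of_eq_pow hw hl, ho]
        simp [List.reduceOption]
        ring
      · rw [outputWeight_succ_of_ne_pow hw hl, ho]
        simp [List.reduceOption]
    · rw [hA.transcript, hA.sum, List.reduceOption_append, List.length_append, Nat.cast_add,
        H.count]
      congr 1
      rcases hA.out with ⟨⟨l, hl⟩, ho⟩ | ⟨hl, ho⟩
      · rw [log_succ_of_eq_pow hw hl, ho]
        simp [List.reduceOption]
      · rw [log_succ_of_ne_pow hw hl, ho]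
        simp [List.reduceOption]
    · rw [hA.sum, List.length_append]
      have := H.total
      push_cast
      simp
      linarith
    · rw [hA.length, update_centers]
      exact hsize

omit [PseudoMetricSpace X] in
theorem Consistent.sum_output_le {k : ℕ} {Δ : ℝ} {h : List X} {s : State X q}
    (H : Consistent k Δ h s) :
    (s.transcript.reduceOption.map Prod.snd).sum ≤ 2 * h.length := by
  have h1 := H.weights fun _ => 1
  simp only [mul_one] at h1
  have h2 : (s.sketch.map fun p => (outputWeight p.2 : ℝ)).sum ≤
      (s.sketch.map fun p => 2 * (p.2 : ℝ)).sum :=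
    List.sum_le_sum fun p hp => by exact_mod_cast outputWeight_le (H.sketch p hp).1
  rw [List.sum_map_mul_left, ← h1] at h2
  have h3 : ((s.transcript.reduceOption.map Prod.snd).sum : ℝ) =
      (s.transcript.reduceOption.map fun p => (p.2 : ℝ)).sum := by
    rw [Nat.cast_list_sum, List.map_map]
    rfl
  have h4 := H.total
  have : ((s.transcript.reduceOption.map Prod.snd).sum : ℝ) ≤ 2 * h.length := by linarith
  exact_mod_cast this

omit [PseudoMetricSpace X] in
theorem Consistent.length_output_le {k : ℕ} {Δ : ℝ} {h : List X} {s : State X q}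
    (H : Consistent k Δ h s) :
    (s.transcript.reduceOption.length : ℝ) ≤
      q * (292 * k * (Real.logb 2 Δ + 1)) * (Nat.log 2 h.length + 1) := by
  have h1 : (s.sketch.map fun p => ((Nat.log 2 p.2 + 1 : ℕ) : ℝ)).sum ≤
      (s.sketch.map fun _ => (Nat.log 2 h.length + 1 : ℝ)).sum := by
    refine List.sum_le_sum fun p hp => ?_
    have h2 : p.2 ≤ h.length := by
      have h3 := List.single_le_sum (l := s.sketch.map fun p => (p.2 : ℝ))
        (by simp +contextual [eq_comm]) p.2
        (List.mem_map.2 ⟨p, hp, rfl⟩)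
      exact_mod_cast h3.trans H.total
    exact_mod_cast Nat.succ_le_succ (Nat.log_mono_right h2)
  rw [H.count]
  refine h1.trans ?_
  simp only [List.map_const', List.sum_replicate, nsmul_eq_mul]
  refine mul_le_mul_of_nonneg_right (H.size.trans ?_) (by positivity)
  refine (Finset.sum_le_sum fun i _ => min_le_right _ _).trans ?_
  simp

theorem Consistent.of_mem_support {k : ℕ} {Δ G : ℝ} (xs : List X) :
    ∀ {h : List X} {s s' : State X q}, Consistent k Δ h s → s' ∈ (run k Δ G s xs).support →
      Consistent k Δ (h ++ xs) s' := by
  induction xs with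
  | nil =>
    intro h s s' H hs'
    obtain rfl : s' = s := by simpa [run] using hs'
    simpa using H
  | cons x xs ih =>
    intro h s s' H hs'
    obtain ⟨s₁, hs₁, hs'⟩ := (PMF.mem_support_bind_iff _ _ _).1 hs'
    obtain ⟨b, -, rfl⟩ := (PMF.mem_support_map_iff _ _ _).1 hs₁
    simpa using ih (H.update x b) hs'

/-! ### Copies that stay within the budget -/

theorem Consistent.represents {k : ℕ} {Δ M : ℝ} {h : List X} {s : State X q}
    (H : Consistent k Δ h s)
    (hM : ∀ f : X → ℝ, (∀ x, 0 ≤ f x) → (∀ x y, f x ≤ f y + dist x y) →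
      |(h.map f).sum - (s.sketch.map fun p => (p.2 : ℝ) * f p.1).sum| ≤ M) :
    Represents h s.transcript.reduceOption M where
  subset p hp := (H.output p hp).2
  le_weighted f h0 h1 := by
    have h2 := (abs_le.1 (hM f h0 h1)).2
    have h3 : (s.sketch.map fun p => (p.2 : ℝ) * f p.1).sum ≤
        (s.sketch.map fun p => (outputWeight p.2 : ℝ) * f p.1).sum :=
      List.sum_le_sum fun p hp =>
        mul_le_mul_of_nonneg_right (by exact_mod_cast le_outputWeight p.2) (h0 _)
    rw [H.weights f]
    linarith
  weighted_le f h0 h1 := by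
    have h2 := (abs_le.1 (hM f h0 h1)).1
    have h3 : (s.sketch.map fun p => (outputWeight p.2 : ℝ) * f p.1).sum ≤
        (s.sketch.map fun p => 2 * ((p.2 : ℝ) * f p.1)).sum :=
      List.sum_le_sum fun p hp => by
        rw [← mul_assoc]
        exact mul_le_mul_of_nonneg_right
          (by exact_mod_cast outputWeight_le (H.sketch p hp).1) (h0 _)
    rw [List.sum_map_mul_left] at h3
    rw [H.weights f]
    linarith

/-- What a copy with centers `S` and accumulated charge `a` within the budget guarantees. -/
structure Tracks (k : ℕ) (Δ G : ℝ) (h : List X) (s : State X q) (S : List X) (a : ℝ≥0∞) :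
    Prop where
  length : (S.length : ℝ≥0∞) ≤ a
  subset : ∀ y ∈ S, ∃ p ∈ s.sketch, p.1 = y
  movement : ∀ f : X → ℝ, (∀ x, 0 ≤ f x) → (∀ x y, f x ≤ f y + dist x y) →
    |(h.map f).sum - (s.sketch.map fun p => (p.2 : ℝ) * f p.1).sum| ≤
      a.toReal * (G / (k * (Real.logb 2 Δ + 1)))
  represents : ∀ m ≤ h.length, Represents (h.take m) (s.transcript.take m).reduceOption
    (a.toReal * (G / (k * (Real.logb 2 Δ + 1))))

theorem Tracks.init (k : ℕ) (Δ G : ℝ) : Tracks k Δ G [] (State.init X q) [] 0 where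
  length := by simp
  subset := by simp
  movement := by simp [State.init]
  represents m _ := by
    constructor <;> simp [State.init]

/-- For `G = 0` a positive distance would make the scaled distance infinite, so finiteness forces
`dist x y = 0`. -/
theorem dist_le_scaledDist {k : ℕ} {Δ G : ℝ} (hK : 0 < k * (Real.logb 2 Δ + 1)) (hG : 0 ≤ G)
    {S : List X} {x y : X} (hy : ∀ z ∈ S, dist x y ≤ dist x z)
    (hs : scaledDist k Δ G S x ≠ ∞) :
    dist x y ≤ (scaledDist k Δ G S x).toReal * (G / (k * (Real.logb 2 Δ + 1))) := by
  have h1 : ENNReal.ofReal (dist x y) * ENNReal.ofReal (k * (Real.logb 2 Δ + 1)) /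
      ENNReal.ofReal G ≤ scaledDist k Δ G S x := by
    refine ENNReal.div_le_div_right (mul_le_mul_left (le_iInf₂ fun z hz => ?_) _) _
    rw [edist_dist]
    exact ENNReal.ofReal_le_ofReal (hy z hz)
  rcases hG.eq_or_lt with rfl | hG
  · rw [ENNReal.ofReal_zero] at h1
    by_contra hlt
    have hpos : 0 < dist x y := by simpa using hlt
    rw [ENNReal.div_zero (mul_ne_zero (ENNReal.ofReal_pos.2 hpos).ne' (ENNReal.ofReal_pos.2 hK).ne'),
      top_le_iff] at h1
    exact hs h1
  · rw [← ENNReal.ofReal_mul dist_nonneg, ← ENNReal.ofReal_div_of_pos hG,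
      ENNReal.ofReal_le_iff_le_toReal hs, div_le_iff₀ hG] at h1
    rwa [← mul_div_assoc, le_div_iff₀ hK]

theorem scaledDist_nil {k : ℕ} {Δ G : ℝ} (hK : 0 < k * (Real.logb 2 Δ + 1)) (x : X) :
    scaledDist k Δ G [] x = ∞ := by
  simp only [scaledDist, List.not_mem_nil, iInf_false, iInf_top]
  rw [ENNReal.top_mul (ENNReal.ofReal_pos.2 hK).ne', ENNReal.top_div_of_ne_top ENNReal.ofReal_ne_top]

/-- The number of centers is at most the charge, so a copy within its charge budget never exceeds
the center budget, and whatever it opens is output. The sketch thus contains its centers, and the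
sketch point nearest to `x` is at least as close as they are. If another copy causes `x` to be
output, nothing moves. -/
theorem Tracks.update {k : ℕ} {Δ G : ℝ} (hK : 0 < k * (Real.logb 2 Δ + 1)) (hG : 0 ≤ G)
    {h : List X} {s : State X q} (C : Consistent k Δ h s) (x : X) (b : Fin q → Bool) (i : Fin q)
    {a : ℝ≥0∞} (H : Tracks k Δ G h s (s.centers i) a)
    (ha : a + charge k Δ G (s.centers i) x (b i) ≤
      ENNReal.ofReal (292 * k * (Real.logb 2 Δ + 1))) :
    Tracks k Δ G (h ++ [x]) (update k Δ s x b) ((update k Δ s x b).centers i)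
      (a + charge k Δ G (s.centers i) x (b i)) := by
  have htop : a + charge k Δ G (s.centers i) x (b i) ≠ ∞ :=
    ne_top_of_le_ne_top ENNReal.ofReal_ne_top ha
  obtain ⟨hatop, hctop⟩ := ENNReal.add_ne_top.1 htop
  have hGK : 0 ≤ G / (k * (Real.logb 2 Δ + 1)) := by positivity
  have hM : (a + charge k Δ G (s.centers i) x (b i)).toReal * (G / (k * (Real.logb 2 Δ + 1))) =
      a.toReal * (G / (k * (Real.logb 2 Δ + 1))) +
      (charge k Δ G (s.centers i) x (b i)).toReal * (G / (k * (Real.logb 2 Δ + 1))) := by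
    rw [ENNReal.toReal_add hatop hctop, add_mul]
  have hc0 : 0 ≤ (charge k Δ G (s.centers i) x (b i)).toReal *
      (G / (k * (Real.logb 2 Δ + 1))) := by positivity
  have hlen : ((openCenters s.centers x b i).length : ℝ≥0∞) ≤
      a + charge k Δ G (s.centers i) x (b i) := by
    cases hb : b i
    · simpa [openCenters, hb] using H.length.trans le_self_add
    · simpa [openCenters, hb, charge] using add_le_add_left H.length 1
  have hopens : b i = true → Opens k Δ s x b := fun hb => by
    refine ⟨i, hb, ?_⟩
    have h1 := hlen.trans ha
    rwa [← ENNReal.ofReal_natCast, ENNReal.ofReal_le_ofReal_iff',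
      or_iff_left (by simp [openCenters, hb]; positivity)] at h1
  have hmove : ∀ f : X → ℝ, (∀ x, 0 ≤ f x) → (∀ x y, f x ≤ f y + dist x y) →
      |((h ++ [x]).map f).sum -
        ((MultiMeyerson.update k Δ s x b).sketch.map fun p => (p.2 : ℝ) * f p.1).sum| ≤
      (a + charge k Δ G (s.centers i) x (b i)).toReal * (G / (k * (Real.logb 2 Δ + 1))) := by
    intro f h0 h1
    have h2 := abs_le.1 (H.movement f h0 h1)
    rw [hM]
    rcases update_cases k Δ s x b with ⟨hO, hs, ht⟩ | ⟨hO, hs0, hs, ht⟩ | ⟨hO, y, w, o, hA⟩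
    · rw [hs]
      simp only [List.map_append, List.map_cons, List.map_nil, List.sum_append, List.sum_cons,
        List.sum_nil, Nat.cast_one, one_mul]
      exact abs_le.2 ⟨by linarith, by linarith⟩
    -- An empty sketch means that the copy has no centers; not opening `x` would then cost an
    -- infinite charge.
    · exfalso
      have hb : b i = false := by simpa using mt hopens hO
      have hnil : s.centers i = [] := List.eq_nil_iff_forall_not_mem.2 fun y hy => by
        obtain ⟨p, hp, -⟩ := H.subset y hy
        simp [hs0] at hp
      rw [hb, hnil] at hctop
      exact hctop (by simpa [charge] using scaledDist_nil hK x)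
    · have hb : b i = false := by simpa using mt hopens hO
      have hd : dist x y ≤ (charge k Δ G (s.centers i) x (b i)).toReal *
          (G / (k * (Real.logb 2 Δ + 1))) := by
        rw [hb] at hctop ⊢
        refine dist_le_scaledDist hK hG (fun z hz => ?_) hctop
        obtain ⟨p, hp, rfl⟩ := H.subset z hz
        exact hA.dist_le p hp
      rw [hA.sum]
      simp only [List.map_append, List.map_cons, List.map_nil, List.sum_append, List.sum_cons,
        List.sum_nil, Nat.cast_add, Nat.cast_one]
      have h3 := h1 x y
      have h4 := h1 y x
      rw [dist_comm y x] at h4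
      exact abs_le.2 ⟨by linarith, by linarith⟩
  refine ⟨?_, ?_, hmove, fun m hm => ?_⟩
  · rw [update_centers]
    exact hlen
  · intro y hy
    rw [update_centers] at hy
    have hy' : y ∈ s.centers i ∨ (y = x ∧ b i = true) := by
      cases hb : b i
      · exact Or.inl (by simpa [openCenters, hb] using hy)
      · simpa [openCenters, hb, or_comm] using hy
    rcases hy' with hy | ⟨rfl, hb⟩
    · obtain ⟨p, hp, rfl⟩ := H.subset y hy
      rcases update_cases k Δ s x b with ⟨-, hs, -⟩ | ⟨-, hs0, -⟩ | ⟨-, y, w, o, hA⟩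
      · exact ⟨p, by simp [hs, hp], rfl⟩
      · simp [hs0] at hp
      · exact hA.exists_mem p hp
    · rcases update_cases k Δ s y b with ⟨-, hs, -⟩ | ⟨hO, -⟩ | ⟨hO, -⟩
      · exact ⟨(y, 1), by simp [hs], rfl⟩
      · exact absurd (hopens hb) hO
      · exact absurd (hopens hb) hO
  · rw [List.length_append, List.length_singleton] at hm
    have C' := C.update x b
    -- Shorter prefixes of the transcript are unchanged and keep their guarantee; only the full
    -- prefix needs the new movement bound.
    rcases Nat.le_or_eq_of_le_succ hm with hm | rfl
    · have ht : (MultiMeyerson.update k Δ s x b).transcript.take m = s.transcript.take m := by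
        have hm' : m ≤ s.transcript.length := C.length ▸ hm
        rcases update_cases k Δ s x b with ⟨-, -, ht⟩ | ⟨-, -, -, ht⟩ | ⟨-, y, w, o, hA⟩
        · rw [ht, List.take_append_of_le_length hm']
        · rw [ht, List.take_append_of_le_length hm']
        · rw [hA.transcript, List.take_append_of_le_length hm']
      rw [ht, List.take_append_of_le_length hm]
      exact (H.represents m hm).mono (by linarith)
    · rw [List.take_of_length_le (by simp), List.take_of_length_le (by rw [C'.length]; simp)]
      exact C'.represents hmove

/-! ### The failure probability of the procedure -/

theorem sum_coinFlips_mul_prod {p : Fin q → ℝ≥0∞} (hp : ∀ i, p i ≤ 1)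
    (g : Fin q → Bool → ℝ≥0∞) :
    ∑ b, coinFlips p hp b * ∏ i, g i (b i) =
      ∏ i, (p i * g i true + (1 - p i) * g i false) := by
  have key := Finset.prod_univ_sum (fun _ : Fin q => (Finset.univ : Finset Bool))
    (fun i c => (if c = true then p i else 1 - p i) * g i c)
  rw [Fintype.piFinset_univ] at key
  simp only [Fintype.sum_bool, if_true, Bool.false_eq_true, if_false] at key
  rw [key]
  refine Finset.sum_congr rfl fun b _ => ?_
  rw [coinFlips, PMF.ofFintype_apply, Finset.prod_mul_distrib]

/-- All prefixes of the transcript represent the points read, with total movement `292 G`. -/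
def RepresentsPrefixes (G : ℝ) (h : List X) (τ : List (Option (X × ℕ))) : Prop :=
  ∀ m ≤ h.length, Represents (h.take m) (τ.take m).reduceOption (292 * G)

/-- Failure of the representation requires every copy to exceed its budget. Given the state, each
factor depends only on that copy's own coin, so the expectation of the product factors at each step.
The charges `a` are bookkeeping outside the state, and tracking is demanded only of copies still
within budget. -/
theorem run_toOuterMeasure_le {k : ℕ} {Δ G : ℝ} (hK : 0 < k * (Real.logb 2 Δ + 1)) (hG : 0 ≤ G)
    (xs : List X) : ∀ (h : List X) (s : State X q) (a : Fin q → ℝ≥0∞), Consistent k Δ h s →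
      (∀ i, a i ≤ ENNReal.ofReal (292 * k * (Real.logb 2 Δ + 1)) →
        Tracks k Δ G h s (s.centers i) (a i)) →
      (run k Δ G s xs).toOuterMeasure {s' | ¬ RepresentsPrefixes G (h ++ xs) s'.transcript} ≤
        ∏ i, failProb k Δ G (s.centers i) (a i) xs := by
  induction xs with
  | nil =>
    intro h s a C H
    rw [run, PMF.toOuterMeasure_pure_apply]
    split_ifs with hs
    -- In the failure event no copy can be within budget, so every factor equals 1.
    · refine (Finset.prod_eq_one fun i _ => ?_).ge
      rw [failProb, if_neg]
      intro hi
      refine hs fun m hm => ?_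
      rw [List.append_nil] at hm ⊢
      refine ((H i hi).represents m hm).mono ?_
      have h1 := ENNReal.toReal_le_of_le_ofReal (by rw [mul_assoc]; positivity) hi
      calc (a i).toReal * (G / (k * (Real.logb 2 Δ + 1)))
          ≤ 292 * k * (Real.logb 2 Δ + 1) * (G / (k * (Real.logb 2 Δ + 1))) := by gcongr
        _ = 292 * G := by rw [mul_assoc 292, mul_assoc 292, mul_div_cancel₀ _ hK.ne']
    · exact zero_le
  | cons x xs ih =>
    intro h s a C H
    rw [run, step, PMF.bind_map, PMF.toOuterMeasure_bind_apply, tsum_fintype]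
    have hstep : ∀ b : Fin q → Bool,
        (run k Δ G (update k Δ s x b) xs).toOuterMeasure
          {s' | ¬ RepresentsPrefixes G (h ++ x :: xs) s'.transcript} ≤
        ∏ i, failProb k Δ G (if b i then x :: s.centers i else s.centers i)
          (a i + charge k Δ G (s.centers i) x (b i)) xs := by
      intro b
      have h1 := ih (h ++ [x]) (update k Δ s x b)
        (fun i => a i + charge k Δ G (s.centers i) x (b i)) (C.update x b)
        (fun i hi => (H i (le_self_add.trans hi)).update hK hG C x b i hi)
      rw [update_centers, List.append_assoc, List.singleton_append] at h1
      exact h1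
    refine (Finset.sum_le_sum fun b _ => mul_le_mul_right (hstep b) _).trans ?_
    rw [sum_coinFlips_mul_prod _ fun i c =>
      failProb k Δ G (if c then x :: s.centers i else s.centers i)
        (a i + charge k Δ G (s.centers i) x c) xs]
    exact le_of_eq rfl

/-! ### The theorem -/

omit [PseudoMetricSpace X] in
theorem initialPart_append_streamPart (p j : ℕ) (τ : List (Option (X × ℕ))) :
    initialPart p τ ++ streamPart p j τ = (τ.take (p + j)).reduceOption := by
  rw [initialPart, streamPart, ← List.reduceOption_append, List.take_add]

theorem exists_state_of_mem_support {k : ℕ} {Δ G : ℝ} (hΔ : 1 ≤ Δ) {P Q : List X}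
    {τ : List (Option (X × ℕ))} (hτ : τ ∈ (procedure k q Δ G P Q).support) :
    ∃ s : State X q, Consistent k Δ (P ++ Q) s ∧ s.transcript = τ := by
  obtain ⟨s, hs, rfl⟩ := (PMF.mem_support_map_iff _ _ _).1 hτ
  exact ⟨s, by simpa using (Consistent.init hΔ).of_mem_support _ hs, rfl⟩

theorem natLog_le_logb (n : ℕ) : (Nat.log 2 n : ℝ) ≤ Real.logb 2 n := by
  simpa using Real.natLog_le_logb n 2

omit [PseudoMetricSpace X] in
theorem length_streamPart_le {k n : ℕ} {Δ : ℝ} (hΔ : 1 ≤ Δ) {P Q : List X}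
    (hn : P.length + Q.length ≤ n) (hq : q = ⌈10 * Real.logb 2 (n + Δ)⌉₊) {s : State X q}
    (C : Consistent k Δ (P ++ Q) s) :
    ((streamPart P.length Q.length s.transcript).length : ℝ) ≤
      k * (12848 * Real.logb 2 (n + Δ) ^ 3) := by
  have hlen : (streamPart P.length Q.length s.transcript).length ≤
      s.transcript.reduceOption.length := by
    have h1 := congrArg List.length
      (initialPart_append_streamPart P.length Q.length s.transcript)
    rw [List.take_of_length_le (by rw [C.length, List.length_append]), List.length_append] at h1
    omega
  have hL0 : 0 ≤ Real.logb 2 (n + Δ) :=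
    Real.logb_nonneg (by norm_num) (by linarith [(Nat.cast_nonneg n : (0 : ℝ) ≤ n)])
  have hR : 0 ≤ k * (12848 * Real.logb 2 (n + Δ) ^ 3) := by positivity
  -- For `n = 0` and `Δ = 1` the logarithm vanishes; for `n ≥ 1` it is at least 1 and absorbs the
  -- additive constants below.
  rcases Nat.eq_zero_or_pos n with rfl | hpos
  · have h0 : s.transcript = [] := by
      rw [← List.length_eq_zero_iff, C.length, List.length_append]
      omega
    rw [h0, streamPart]
    simp only [List.drop_nil, List.take_nil, List.reduceOption_nil, List.length_nil, Nat.cast_zero] at hR ⊢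
    exact hR
  have hn1 : (1 : ℝ) ≤ n := by exact_mod_cast hpos
  have hL1 : 1 ≤ Real.logb 2 (n + Δ) := by
    rw [Real.le_logb_iff_rpow_le (by norm_num) (by linarith)]
    norm_num
    linarith
  have hΔL : Real.logb 2 Δ ≤ Real.logb 2 (n + Δ) :=
    Real.logb_le_logb_of_le (by norm_num) (by linarith) (by linarith)
  have hnL : (Nat.log 2 (P ++ Q).length : ℝ) ≤ Real.logb 2 (n + Δ) := by
    have h1 : (Nat.log 2 (P ++ Q).length : ℝ) ≤ Nat.log 2 n := by
      exact_mod_cast Nat.log_mono_right (by simpa using hn)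
    exact (h1.trans (natLog_le_logb n)).trans
      (Real.logb_le_logb_of_le (by norm_num) (by linarith) (by linarith))
  have hq' := (Nat.ceil_lt_add_one (a := 10 * Real.logb 2 (n + Δ)) (by positivity)).le
  rw [← hq] at hq'
  have hlogΔ : 0 ≤ Real.logb 2 Δ := Real.logb_nonneg (by norm_num) hΔ
  have hout := C.length_output_le
  set Λ := Real.logb 2 (n + Δ)
  calc ((streamPart P.length Q.length s.transcript).length : ℝ)
      ≤ s.transcript.reduceOption.length := by exact_mod_cast hlen
    _ ≤ _ := hout
    -- The factors bound the number of copies, the budget per copy and the number of outputs per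
    -- sketch point; `11 * 292 * 2 * 2 = 12848`.
    _ ≤ (11 * Λ) * (292 * k * (2 * Λ)) * (2 * Λ) := by
        gcongr
        · linarith
        · linarith
        · linarith
    _ = k * (12848 * Λ ^ 3) := by ring

theorem inv_two_pow_ceil_le {x : ℝ} (hx : 1 ≤ x) :
    ((2 : ℝ≥0∞)⁻¹) ^ ⌈10 * Real.logb 2 x⌉₊ ≤ ENNReal.ofReal (1 / x ^ 10) := by
  have h2 : (2 : ℝ≥0∞)⁻¹ = ENNReal.ofReal 2⁻¹ := by
    rw [ENNReal.ofReal_inv_of_pos (by norm_num)]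
    simp
  rw [h2, ← ENNReal.ofReal_pow (by norm_num)]
  refine ENNReal.ofReal_le_ofReal ?_
  rw [inv_pow, ← one_div]
  refine one_div_le_one_div_of_le (by positivity) ?_
  calc x ^ 10 = (2 : ℝ) ^ (10 * Real.logb 2 x) := by
        rw [mul_comm, Real.rpow_mul (by norm_num),
          Real.rpow_logb (by norm_num) (by norm_num) (by linarith)]
        exact_mod_cast (Real.rpow_natCast x 10).symm
    _ ≤ (2 : ℝ) ^ ((⌈10 * Real.logb 2 x⌉₊ : ℕ) : ℝ) :=
        Real.rpow_le_rpow_of_exponent_le (by norm_num) (Nat.le_ceil _)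
    _ = _ := Real.rpow_natCast _ _

theorem ofReal_one_sub_le_toOuterMeasure {α : Type*} (p : PMF α) {s : Set α} {ε : ℝ}
    (hε : 0 ≤ ε) (h : p.toOuterMeasure sᶜ ≤ ENNReal.ofReal ε) :
    ENNReal.ofReal (1 - ε) ≤ p.toOuterMeasure s := by
  rw [ENNReal.ofReal_sub _ hε, ENNReal.ofReal_one, tsub_le_iff_right]
  have h1 : p.toOuterMeasure Set.univ = 1 :=
    (p.toOuterMeasure_apply_eq_one_iff _).2 (Set.subset_univ _)
  rw [← h1, ← Set.union_compl_self s]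
  exact (MeasureTheory.measure_union_le _ _).trans (by gcongr)

/-- All copies start with charge zero, so each factor of the product bound is the failure
probability of a fresh copy. -/
theorem procedure_toOuterMeasure_le {k : ℕ} {Δ G : ℝ} (hk : 1 ≤ k) (hΔ : 1 ≤ Δ) (hG0 : 0 ≤ G)
    (P Q : List X)
    (hD : ∀ x ∈ P ++ Q, ∀ y ∈ P ++ Q, dist x y = 0 ∨ (1 ≤ dist x y ∧ dist x y ≤ Δ))
    (hG : opt k Δ (unitWeights (P ++ Q)) ≤ 18 * G) :
    (procedure k q Δ G P Q).toOuterMeasure {τ | ¬ RepresentsPrefixes G (P ++ Q) τ} ≤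
      2⁻¹ ^ q := by
  have hK : 0 < k * (Real.logb 2 Δ + 1) := by
    have := Real.logb_nonneg (b := 2) (by norm_num) hΔ
    have : (1 : ℝ) ≤ k := by exact_mod_cast hk
    positivity
  rw [procedure, PMF.toOuterMeasure_map_apply]
  refine (run_toOuterMeasure_le hK hG0 (P ++ Q) [] (State.init X q) (fun _ => 0)
    (Consistent.init hΔ) fun i _ => Tracks.init k Δ G).trans ?_
  refine (Finset.prod_le_prod' fun i _ => failProb_nil_le_half hk hΔ (P ++ Q) hD hG).trans ?_
  simp

end MultiMeyerson

end

theorem mainTheorem6 :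
    ∃ (c C A : ℝ) (a : ℕ), 0 < c ∧ 0 < C ∧ 0 < A ∧
      ∀ (X : Type*) [PseudoMetricSpace X] (k n : ℕ) (Δ G : ℝ) (P' σ' : List X),
        1 ≤ k →
        1 ≤ Δ →
        (∀ x ∈ P' ++ σ', ∀ y ∈ P' ++ σ', dist x y = 0 ∨ (1 ≤ dist x y ∧ dist x y ≤ Δ)) →
        P'.length + σ'.length ≤ n →
        MultiMeyerson.opt k Δ (MultiMeyerson.unitWeights (P' ++ σ')) ≤
          18 * MultiMeyerson.opt k Δ (MultiMeyerson.unitWeights P') →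
        MultiMeyerson.opt k Δ (MultiMeyerson.unitWeights P') ≤ G →
        G ≤ 3 * MultiMeyerson.opt k Δ (MultiMeyerson.unitWeights P') →
        -- the length of the stream and the weights, for every possible outcome
        (∀ τ ∈ (MultiMeyerson.procedure k ⌈c * Real.logb 2 (n + Δ)⌉₊ Δ G P' σ').support,
          ((MultiMeyerson.streamPart P'.length σ'.length τ).length : ℝ) ≤
              k * (A * Real.logb 2 (n + Δ) ^ a) ∧
          (∀ p ∈ MultiMeyerson.initialPart P'.length τ ++
              MultiMeyerson.streamPart P'.length σ'.length τ, 0 < p.2) ∧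
          ((MultiMeyerson.initialPart P'.length τ ++
              MultiMeyerson.streamPart P'.length σ'.length τ).map Prod.snd).sum ≤ 2 * n) ∧
        -- the quality of the weighted instance, at all times simultaneously
        ENNReal.ofReal (1 - 1 / (n + Δ) ^ 10) ≤
          (MultiMeyerson.procedure k ⌈c * Real.logb 2 (n + Δ)⌉₊ Δ G P' σ').toOuterMeasure
            {τ | ∀ j ≤ σ'.length, ∀ (α : ℝ) (U : Finset X), 0 ≤ α →
              MultiMeyerson.IsApproxSolution k Δ α U
                (MultiMeyerson.initialPart P'.length τ ++
                  MultiMeyerson.streamPart P'.length j τ) →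
              MultiMeyerson.IsApproxSolution k Δ (C * (α + 1)) U
                (MultiMeyerson.unitWeights (P' ++ σ'.take j))} := by
  refine ⟨10, 7012, 12848, 3, by norm_num, by norm_num, by norm_num, ?_⟩
  intro X _ k n Δ G P' σ' hk hΔ hD hn h18 hG hG3
  have hΔ0 : 0 ≤ Δ := by linarith
  have hx : 1 ≤ n + Δ := by linarith [(Nat.cast_nonneg n : (0 : ℝ) ≤ n)]
  refine ⟨fun τ hτ => ?_, ?_⟩
  · obtain ⟨s, C, rfl⟩ := MultiMeyerson.exists_state_of_mem_support hΔ hτ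
    have hlen : s.transcript.length = P'.length + σ'.length := by
      rw [C.length, List.length_append]
    rw [MultiMeyerson.initialPart_append_streamPart, List.take_of_length_le hlen.le]
    refine ⟨MultiMeyerson.length_streamPart_le hΔ hn rfl C, fun p hp => (C.output p hp).1, ?_⟩
    have h1 := C.sum_output_le
    rw [List.length_append] at h1
    omega
  · refine MultiMeyerson.ofReal_one_sub_le_toOuterMeasure _ (by positivity) ?_
    refine le_trans (MeasureTheory.measure_mono ?_)
      ((MultiMeyerson.procedure_toOuterMeasure_le hk hΔ
        ((MultiMeyerson.opt_nonneg k hΔ0 _).trans hG) P' σ' hD (by linarith)).trans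
        (MultiMeyerson.inv_two_pow_ceil_le hx))
    -- The prefix of length `P'.length + j` is the one present after the `j`-th stream insertion, so
    -- representing all prefixes handles every `j` at once.
    refine Set.compl_subset_comm.1 fun τ hτ j hj α U hα hU => ?_
    have hrep : MultiMeyerson.RepresentsPrefixes G (P' ++ σ') τ := by simpa using hτ
    have h1 := hrep (P'.length + j) (by simpa using hj)
    rw [List.take_length_add_append, ← MultiMeyerson.initialPart_append_streamPart] at h1
    exact h1.isApproxSolution hΔ0 le_rfl hG3 hα hU
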